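/- Let $T=(V,E)$ be a free tree with $n=|V|\ge 1$ vertices. A linear arrangement of $T$ is a bijection $\pi:V\to\{1,\dots,n\}$, and $D_\pi(T)=\sum_{uv\in E}|\pi(u)-\pi(v)|$ is its sum of edge lengths. The arrangement $\pi$ is planar if there are no two edges $\{s,t\},\{u,v\}\in E$ with $\pi(s)<\pi(u)<\pi(t)<\pi(v)$. For $r\in V$ let $T^r$ denote $T$ rooted at $r$; the arrangement $\pi$ is a projective arrangement of $T^r$ if it is planar and there is no edge $\{s,t\}\in E$ with $\pi(s)<\pi(r)<\pi(t)$. Let $\mathbb{E}_{\mathrm{pl}}[D(T)]$ be the expected value of $D_\pi(T)$ for $\pi$ uniformly random among the planar arrangements of $T$, let $\mathbb{E}_{\mathrm{pr}}[D(T^u)]$ be the expected value of $D_\pi(T)$ for $\pi$ uniformly random among the projective arrangements of $T^u$, and let $\mathbb{E}^{\ast}_{\mathrm{pr}}[D(T^u)]$ be the expected value of $D_\pi(T)$ for $\pi$ uniformly random among the projective arrangements of $T^u$ with $\pi(u)=1$. Then all these sets of arrangements are nonempty (so that the expectations are defined), and $$\mathbb{E}_{\mathrm{pl}}[D(T)]=\frac1n\sum_{u\in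 V}\mathbb{E}^{\ast}_{\mathrm{pr}}[D(T^u)]=\frac{(n-1)(n-2)}{6n}+\frac1n\sum_{u\in V}\mathbb{E}_{\mathrm{pr}}[D(T^u)].$$ -/

import Mathlib

namespace LinArr

/-- Linear arrangements of a finite vertex set `V` with `n` elements: bijections from `V` onto
the `n` positions. The positions `1, …, n` are encoded by `Fin n` shifted by one, see `pos`. -/
abbrev Arrangement (V : Type*) [Fintype V] := V ≃ Fin (Fintype.card V)

variable {V : Type*} [Fintype V]

/-- The position of the vertex `u` in the arrangement `π`, an integer in `{1, …, n}`. -/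
def pos (π : Arrangement V) (u : V) : ℕ := (π u : ℕ) + 1

/-- `π` is planar: no two edges `{s, t}`, `{u, v}` cross, that is, satisfy
`π(s) < π(u) < π(t) < π(v)`. -/
def IsPlanar (G : SimpleGraph V) (π : Arrangement V) : Prop :=
  ∀ s t u v : V, G.Adj s t → G.Adj u v →
    ¬ (pos π s < pos π u ∧ pos π u < pos π t ∧ pos π t < pos π v)

/-- The vertex `r` is covered by some edge `{s, t}` in `π`. Both orientations of the edge are
included since `G.Adj` is symmetric. -/
def IsCovered (G : SimpleGraph V) (r : V) (π : Arrangement V) : Prop :=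
  ∃ s t : V, G.Adj s t ∧ pos π s < pos π r ∧ pos π r < pos π t

/-- `π` is projective for `G` rooted at `r`: it is planar and the root is not covered. -/
def IsProjective (G : SimpleGraph V) (r : V) (π : Arrangement V) : Prop :=
  IsPlanar G π ∧ ¬ IsCovered G r π

/-- The length `|π(u) - π(v)|` of the edge `e = {u, v}` in `π`. -/
def edgeLength (π : Arrangement V) (e : Sym2 V) : ℝ :=
  Sym2.lift ⟨fun u v => |(pos π u : ℝ) - (pos π v : ℝ)|, fun _ _ => abs_sub_comm _ _⟩ e

open Classical in
/-- The sum `D` of the edge lengths in `π`. -/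
noncomputable def sumEdgeLengths (G : SimpleGraph V) (π : Arrangement V) : ℝ :=
  ∑ e ∈ G.edgeFinset, edgeLength π e

open Classical in
/-- The set of planar arrangements of `G`. -/
noncomputable def planarArrangements (G : SimpleGraph V) : Finset (Arrangement V) :=
  Finset.univ.filter fun π => IsPlanar G π

open Classical in
/-- The set of projective arrangements of `G` rooted at `r`. -/
noncomputable def projectiveArrangements (G : SimpleGraph V) (r : V) :
    Finset (Arrangement V) :=
  Finset.univ.filter fun π => IsProjective G r π

open Classical in
/-- The set of projective arrangements of `G` rooted at `r` with the root in the first position. -/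
noncomputable def projectiveArrangementsFixed (G : SimpleGraph V) (r : V) :
    Finset (Arrangement V) :=
  (projectiveArrangements G r).filter fun π => pos π r = 1

/-- Expected sum of edge lengths in a uniformly random planar arrangement of `G`. -/
noncomputable def expPlanar (G : SimpleGraph V) : ℝ :=
  (planarArrangements G).expect fun π => sumEdgeLengths G π

/-- Expected sum of edge lengths in a uniformly random projective arrangement of `G` rooted
at `r`. -/
noncomputable def expProjective (G : SimpleGraph V) (r : V) : ℝ :=
  (projectiveArrangements G r).expect fun π => sumEdgeLengths G π

/-- Expected sum of edge lengths in a uniformly random projective arrangement of `G` rooted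
at `r` among those with `r` in the first position. -/
noncomputable def expProjectiveFixed (G : SimpleGraph V) (r : V) : ℝ :=
  (projectiveArrangementsFixed G r).expect fun π => sumEdgeLengths G π

end LinArr

namespace LinArr

/-! ### Arrangements as linear orders on the vertices. -/

section Order

variable {V : Type*} [Fintype V]

/-! Crossing is a property of the cyclic order, so rotations preserve planarity. They biject the
planar arrangements starting at `u` with those starting at `v`. An arrangement starting at `u` never
covers `u`, so these classes are the sets `projectiveArrangementsFixed`; they have equal size and
partition the planar arrangements, which gives the first equality (`expPlanar_eq_average`).

For the second, fix a root `u` of degree `d` and compare the two rooted expectations. In a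
projective arrangement `u` and its `d` branches are intervals, and exchanging the root with a
branch, keeping the order inside every block, is an involution (`swapBranch`). Edges avoiding `u`
keep their length, so their expected total is the same whether or not `u` is first. For edges at
`u`: if `u` is first, reflection gives mean length `n/2` each. In general, length is one plus the
number of vertices in between; by the exchange symmetry a vertex lies between `u` and its neighbour
`v` with probability `1/2` if it is another vertex of the branch of `v`, and `1/3` if it is in
another branch. The difference is `(d - 1)(n - 1)/6` (`expProjectiveFixed_eq`), and the sum of `d -
1` over all vertices of a tree is `n - 2`. -/

theorem pos_lt_pos_iff {π : Arrangement V} {x y : V} : pos π x < pos π y ↔ π x < π y := by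
  simp [pos]

/-- The arrangement that lists the vertices by increasing values of `f`. -/
noncomputable def ofKey {α : Type*} [LinearOrder α] (f : V → α) (hf : Function.Injective f) :
    Arrangement V :=
  letI : LinearOrder V := LinearOrder.lift' f hf
  (Fintype.orderIsoFinOfCardEq V rfl).symm.toEquiv

theorem ofKey_lt_ofKey_iff {α : Type*} [LinearOrder α] (f : V → α) (hf : Function.Injective f)
    (x y : V) : ofKey f hf x < ofKey f hf y ↔ f x < f y := by
  let : LinearOrder V := LinearOrder.lift' f hf
  exact (Fintype.orderIsoFinOfCardEq V rfl).symm.lt_iff_lt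

/-- The only order automorphism of `Fin n` is the identity. -/
theorem arrangement_ext {π ρ : Arrangement V} (h : ∀ x y, π x < π y ↔ ρ x < ρ y) : π = ρ := by
  have hle : ∀ x y, π x ≤ π y ↔ ρ x ≤ ρ y := fun x y => by
    rw [← not_lt, ← not_lt, h]
  let e : Fin (Fintype.card V) ≃o Fin (Fintype.card V) :=
    ⟨π.symm.trans ρ, fun {a b} => by simp [← hle]⟩
  have he : e = OrderIso.refl _ := Subsingleton.elim _ _
  ext x
  have := congrArg (fun f : Fin (Fintype.card V) ≃o Fin (Fintype.card V) => f (π x)) he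
  simp only [OrderIso.refl_apply] at this
  rw [← this]
  simp [e]

theorem isPlanar_iff {G : SimpleGraph V} {π : Arrangement V} :
    IsPlanar G π ↔ ∀ s t u v : V, G.Adj s t → G.Adj u v →
      π s < π u → π u < π t → π t < π v → False := by
  simp only [IsPlanar, pos_lt_pos_iff]
  grind

theorem not_isCovered_iff {G : SimpleGraph V} {r : V} {π : Arrangement V} :
    ¬ IsCovered G r π ↔ ∀ s t : V, G.Adj s t → π s < π r → π r < π t → False := by
  simp only [IsCovered, pos_lt_pos_iff]
  grind

theorem mem_planarArrangements {G : SimpleGraph V} {π : Arrangement V} :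
    π ∈ planarArrangements G ↔ IsPlanar G π := by
  simp [planarArrangements]

theorem mem_projectiveArrangements {G : SimpleGraph V} {r : V} {π : Arrangement V} :
    π ∈ projectiveArrangements G r ↔ IsProjective G r π := by
  simp [projectiveArrangements]

theorem not_isCovered_of_first {G : SimpleGraph V} {r : V} {π : Arrangement V}
    (h : (π r : ℕ) = 0) : ¬ IsCovered G r π :=
  not_isCovered_iff.2 fun s t _ hs _ => by simp [Fin.lt_def, h] at hs

theorem mem_projectiveArrangementsFixed {G : SimpleGraph V} {r : V} {π : Arrangement V} :
    π ∈ projectiveArrangementsFixed G r ↔ IsPlanar G π ∧ (π r : ℕ) = 0 := by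
  simp only [projectiveArrangementsFixed, Finset.mem_filter, mem_projectiveArrangements, pos,
    IsProjective, Nat.add_eq_right]
  exact ⟨fun h => ⟨h.1.1, h.2⟩, fun h => ⟨⟨h.1, not_isCovered_of_first h.2⟩, h.2⟩⟩

end Order

/-! ### Existence of planar arrangements, by removing leaves. -/

section Existence

/-- A finite tree has an injective placement on the integer line without crossings. -/
theorem exists_noncrossing_placement (n : ℕ) : ∀ {V : Type*} [Fintype V] (G : SimpleGraph V),
    G.IsTree → Fintype.card V = n → ∃ f : V → ℤ, Function.Injective f ∧
      ∀ s t u v, G.Adj s t → G.Adj u v → f s < f u → f u < f t → f t < f v → False := by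
  classical
  induction n with
  | zero =>
    intro V _ G hG hn
    have := hG.connected.nonempty
    exact absurd hn Fintype.card_ne_zero
  | succ n ih =>
    intro V _ G hG hn
    rcases subsingleton_or_nontrivial V with hV | hV
    · refine ⟨fun _ => 0, fun _ _ _ => Subsingleton.elim _ _, fun s t _ _ h => ?_⟩
      exact absurd (Subsingleton.elim s t) h.ne
    obtain ⟨l, hl⟩ := hG.exists_vert_degree_one_of_nontrivial
    obtain ⟨p, hp, hpu⟩ := SimpleGraph.degree_eq_one_iff_existsUnique_adj.1 hl
    have htree : (G.induce ({l}ᶜ : Set V)).IsTree :=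
      ⟨hG.connected.induce_compl_singleton_of_degree_eq_one hl, hG.isAcyclic.induce _⟩
    obtain ⟨f, hf, hcross⟩ := ih _ htree (by
      rw [Fintype.card_compl_set]; simp [hn])
    have hpl : p ≠ l := hp.ne'
    -- Doubling opens a gap right after the neighbour `p`; the leaf goes there, so its edge has
    -- nothing strictly beneath it.
    let g : V → ℤ := fun x => if h : x = l then 2 * f ⟨p, hpl⟩ + 1 else 2 * f ⟨x, h⟩
    have hgl : g l = g p + 1 := by simp [g, hpl]
    have hg : ∀ x (h : x ≠ l), g x = 2 * f ⟨x, h⟩ := fun x h => by simp [g, h]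
    have hinj : ∀ x (h : x ≠ l) y (h' : y ≠ l), f ⟨x, h⟩ = f ⟨y, h'⟩ → x = y :=
      fun x h y h' e => congrArg Subtype.val (hf e)
    refine ⟨g, fun x y hxy => ?_, fun s t u v hst huv h1 h2 h3 => ?_⟩
    · by_cases hx : x = l <;> by_cases hy : y = l
      · rw [hx, hy]
      · subst hx; rw [hgl, hg p hpl, hg y hy] at hxy; omega
      · subst hy; rw [hgl, hg p hpl, hg x hx] at hxy; omega
      · rw [hg x hx, hg y hy] at hxy
        exact hinj x hx y hy (by omega)
    · have hs : s ≠ l := by rintro rfl; rw [hpu t hst] at h2; omega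
      have ht : t ≠ l := by rintro rfl; rw [hpu s hst.symm] at h1; omega
      have hu : u ≠ l := by rintro rfl; rw [hpu v huv] at h3; omega
      have hv : v ≠ l := by rintro rfl; rw [hpu u huv.symm] at h2; omega
      rw [hg _ hs, hg _ hu] at h1
      rw [hg _ hu, hg _ ht] at h2
      rw [hg _ ht, hg _ hv] at h3
      exact hcross ⟨s, hs⟩ ⟨t, ht⟩ ⟨u, hu⟩ ⟨v, hv⟩ hst huv (by omega) (by omega) (by omega)

theorem planarArrangements_nonempty {V : Type*} [Fintype V] {G : SimpleGraph V} (hG : G.IsTree) :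
    (planarArrangements G).Nonempty := by
  obtain ⟨f, hf, h⟩ := exists_noncrossing_placement _ G hG rfl
  refine ⟨ofKey f hf, mem_planarArrangements.2 (isPlanar_iff.2 ?_)⟩
  simpa only [ofKey_lt_ofKey_iff] using h

end Existence

/-! ### Rotation and reflection; the first equality. -/

section Cyclic

variable {V : Type*} [Fintype V]

/-- The cyclic rotation of `π` that brings `v` to the first position. -/
def rotateTo (π : Arrangement V) (v : V) : Arrangement V :=
  haveI : NeZero (Fintype.card V) := ⟨(Fintype.card_pos_iff.2 ⟨v⟩).ne'⟩
  π.trans (Equiv.subRight (π v))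

/-- The reflection of `π` that fixes the first position. -/
def reflect [NeZero (Fintype.card V)] (π : Arrangement V) : Arrangement V :=
  π.trans (Equiv.neg _)

theorem rotateTo_val (π : Arrangement V) (v x : V) :
    (rotateTo π v x : ℕ) = if (π v : ℕ) ≤ π x then (π x : ℕ) - π v
      else Fintype.card V + π x - π v := by
  have : NeZero (Fintype.card V) := ⟨(Fintype.card_pos_iff.2 ⟨v⟩).ne'⟩
  have h1 := (π v).isLt
  have h2 := (π x).isLt
  simp only [rotateTo, Equiv.trans_apply, Equiv.subRight_apply, Fin.sub_def]
  split_ifs with h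
  · rw [show Fintype.card V - (π v : ℕ) + π x = (π x - π v) + Fintype.card V by omega,
      Nat.add_mod_right, Nat.mod_eq_of_lt (by omega)]
  · rw [Nat.mod_eq_of_lt (by omega)]; omega

theorem reflect_val [NeZero (Fintype.card V)] (π : Arrangement V) (x : V) :
    (reflect π x : ℕ) = if (π x : ℕ) = 0 then 0 else Fintype.card V - π x := by
  have h2 := (π x).isLt
  simp only [reflect, Equiv.trans_apply, Equiv.neg_apply, Fin.val_neg']
  split_ifs with h
  · simp [h]
  · rw [Nat.mod_eq_of_lt (by omega)]

theorem reflect_reflect [NeZero (Fintype.card V)] (π : Arrangement V) :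
    reflect (reflect π) = π := by
  ext x; simp [reflect]

theorem rotateTo_rotateTo {π : Arrangement V} {u v : V} (h : (π u : ℕ) = 0) :
    rotateTo (rotateTo π v) u = π := by
  have h1 := (π v).isLt
  ext x
  have h2 := (π x).isLt
  simp only [rotateTo_val, h]
  split_ifs <;> omega

theorem isPlanar_rotateTo {G : SimpleGraph V} {π : Arrangement V} (h : IsPlanar G π) (v : V) :
    IsPlanar G (rotateTo π v) := by
  simp only [IsPlanar, pos_lt_pos_iff] at h ⊢
  rintro a b c d hab hcd ⟨h1, h2, h3⟩
  -- The four cyclic shifts of a crossing pattern; before the rotation exactly one of them was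
  -- present.
  have e1 := h a b c d hab hcd
  have e2 := h c d b a hcd hab.symm
  have e3 := h b a d c hab.symm hcd.symm
  have e4 := h d c a b hcd.symm hab
  have l0 := (π v).isLt
  have la := (π a).isLt
  have lb := (π b).isLt
  have lc := (π c).isLt
  have ld := (π d).isLt
  simp only [Fin.lt_def, rotateTo_val] at *
  split_ifs at * <;> omega

theorem isPlanar_reflect [NeZero (Fintype.card V)] {G : SimpleGraph V} {π : Arrangement V}
    (h : IsPlanar G π) : IsPlanar G (reflect π) := by
  simp only [IsPlanar, pos_lt_pos_iff] at h ⊢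
  rintro a b c d hab hcd ⟨h1, h2, h3⟩
  -- A crossing is reversed, except that a vertex in position `0` stays first; only `a` can be that
  -- vertex.
  have e1 := h d c b a hcd.symm hab.symm
  have e2 := h a b d c hab hcd.symm
  have la := (π a).isLt
  have lb := (π b).isLt
  have lc := (π c).isLt
  have ld := (π d).isLt
  simp only [Fin.lt_def, reflect_val] at *
  split_ifs at * <;> omega

theorem rotateTo_mem_projectiveArrangementsFixed {G : SimpleGraph V} {π : Arrangement V}
    (h : IsPlanar G π) (v : V) : rotateTo π v ∈ projectiveArrangementsFixed G v :=
  mem_projectiveArrangementsFixed.2 ⟨isPlanar_rotateTo h v, by simp [rotateTo_val]⟩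

theorem card_projectiveArrangementsFixed_eq (G : SimpleGraph V) (u v : V) :
    (projectiveArrangementsFixed G u).card = (projectiveArrangementsFixed G v).card := by
  refine Finset.card_nbij' (fun π => rotateTo π v) (fun π => rotateTo π u) ?_ ?_ ?_ ?_
  · exact fun π hπ => rotateTo_mem_projectiveArrangementsFixed
      (mem_projectiveArrangementsFixed.1 hπ).1 v
  · exact fun π hπ => rotateTo_mem_projectiveArrangementsFixed
      (mem_projectiveArrangementsFixed.1 hπ).1 u
  · exact fun π hπ => rotateTo_rotateTo (mem_projectiveArrangementsFixed.1 hπ).2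
  · exact fun π hπ => rotateTo_rotateTo (mem_projectiveArrangementsFixed.1 hπ).2

theorem sum_planarArrangements (G : SimpleGraph V) [Nonempty V] (F : Arrangement V → ℝ) :
    ∑ π ∈ planarArrangements G, F π = ∑ u, ∑ π ∈ projectiveArrangementsFixed G u, F π := by
  classical
  have : NeZero (Fintype.card V) := ⟨Fintype.card_ne_zero⟩
  rw [← Finset.sum_fiberwise (planarArrangements G) (fun π => π.symm 0)]
  refine Finset.sum_congr rfl fun u _ => Finset.sum_congr ?_ fun _ _ => rfl
  ext π
  rw [Finset.mem_filter, mem_planarArrangements, mem_projectiveArrangementsFixed,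
    Equiv.symm_apply_eq, Fin.ext_iff, Fin.val_zero, eq_comm (a := 0)]

theorem expPlanar_eq_average {G : SimpleGraph V} (hG : G.IsTree) :
    expPlanar G = 1 / (Fintype.card V : ℝ) * ∑ u : V, expProjectiveFixed G u := by
  have := hG.connected.nonempty
  obtain ⟨r⟩ := this
  have : Nonempty V := ⟨r⟩
  set N := (projectiveArrangementsFixed G r).card with hN
  have hc : ∀ u, (projectiveArrangementsFixed G u).card = N :=
    fun u => card_projectiveArrangementsFixed_eq G u r
  have htot : ((planarArrangements G).card : ℝ) = Fintype.card V * N := by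
    have := sum_planarArrangements G (fun _ => (1 : ℝ))
    simpa [hc] using this
  simp only [expPlanar, expProjectiveFixed, Finset.expect_eq_sum_div_card, hc, htot,
    sum_planarArrangements, ← Finset.sum_div]
  rw [div_mul_div_comm, one_mul]

/-- The sum of the distances from the root to a vertex `v` over the planar arrangements that start
with the root. -/
theorem sum_fixed_dist (G : SimpleGraph V) {u v : V} (huv : u ≠ v) :
    ∑ π ∈ projectiveArrangementsFixed G u, |(pos π u : ℝ) - pos π v| =
      (projectiveArrangementsFixed G u).card * ((Fintype.card V : ℝ) / 2) := by
  have : NeZero (Fintype.card V) := ⟨(Fintype.card_pos_iff.2 ⟨v⟩).ne'⟩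
  -- Reflection permutes these arrangements and turns the distance `k` from root to `v` into `n -
  -- k`, so the mean is `n/2`.
  have hrefl : ∑ π ∈ projectiveArrangementsFixed G u, |(pos π u : ℝ) - pos π v| =
      ∑ π ∈ projectiveArrangementsFixed G u, |(pos (reflect π) u : ℝ) - pos (reflect π) v| := by
    have hmem : ∀ π ∈ projectiveArrangementsFixed G u,
        reflect π ∈ projectiveArrangementsFixed G u := fun π hπ => by
      rw [mem_projectiveArrangementsFixed] at hπ ⊢
      exact ⟨isPlanar_reflect hπ.1, by simp [reflect_val, hπ.2]⟩
    exact Finset.sum_nbij' reflect reflect hmem hmem (fun π _ => reflect_reflect π)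
      (fun π _ => reflect_reflect π) fun π _ => by rw [reflect_reflect]
  have hadd : ∑ π ∈ projectiveArrangementsFixed G u, (|(pos π u : ℝ) - pos π v| +
      |(pos (reflect π) u : ℝ) - pos (reflect π) v|) =
      ∑ π ∈ projectiveArrangementsFixed G u, (Fintype.card V : ℝ) := by
    refine Finset.sum_congr rfl fun π hπ => ?_
    have h0 := (mem_projectiveArrangementsFixed.1 hπ).2
    have hv : (π v : ℕ) ≠ 0 := fun h => huv (π.injective (Fin.ext (h0.trans h.symm)))
    have hlt : (π v : ℕ) ≤ Fintype.card V := (π v).isLt.le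
    have hlt' : ((π v : ℕ) : ℝ) ≤ Fintype.card V := by exact_mod_cast hlt
    simp only [pos, reflect_val, h0, hv, if_true, if_false]
    push_cast [Nat.cast_sub hlt]
    rw [abs_of_nonpos (by linarith [Nat.cast_nonneg (α := ℝ) (π v : ℕ)]),
      abs_of_nonpos (by linarith)]
    ring
  rw [Finset.sum_add_distrib, ← hrefl, Finset.sum_const, nsmul_eq_mul] at hadd
  linarith

end Cyclic

/-! ### Branches of a tree at its root. -/

section BranchMap

variable {V : Type*}

/-- `b` sends the root `u` to itself and every other vertex `x` to the neighbour of `u` in the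
branch of `x`; the branches at `u` are the fibres of `b`. -/
structure IsBranchMap (G : SimpleGraph V) (u : V) (b : V → V) : Prop where
  root : b u = u
  adj : ∀ {x}, x ≠ u → G.Adj u (b x)
  of_adj_root : ∀ {v}, G.Adj u v → b v = v
  of_adj : ∀ {s t}, G.Adj s t → s ≠ u → t ≠ u → b s = b t
  walk : ∀ x, ∃ p : G.Walk (b x) x, ∀ z ∈ p.support, b z = b x

/-- The value at `x` is the second vertex of the unique path from `u` to `x`. -/
theorem exists_isBranchMap {G : SimpleGraph V} (hG : G.IsTree) (u : V) :
    ∃ b, IsBranchMap G u b := by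
  classical
  choose p hp hpu using fun x => hG.existsUnique_path u x
  have huniq : ∀ {x} (q : G.Walk u x), q.IsPath → q.snd = (p x).snd :=
    fun {x} q hq => by rw [hpu x q hq]
  have hroot : (p u).snd = u := by
    rw [← huniq _ SimpleGraph.Walk.IsPath.nil]; rfl
  have hadjroot : ∀ {v}, G.Adj u v → (p v).snd = v := fun {v} h => by
    rw [← huniq (.cons h .nil) (by simp [h.ne])]; rfl
  have hstep : ∀ {s t}, G.Adj s t → s ≠ u → t ≠ u → (p s).snd = (p t).snd := by
    intro s t hst hs ht
    -- The path to `t` is either an initial segment of the path to `s` or its extension by one edge;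
    -- both keep the second vertex.
    by_cases hmem : t ∈ (p s).support
    · rw [← huniq _ ((hp s).takeUntil hmem), SimpleGraph.Walk.snd_takeUntil ht]
    · rw [← huniq _ ((hp s).concat hmem hst)]
      generalize p s = q
      cases q with
      | nil => exact absurd rfl hs
      | cons h q => simp [SimpleGraph.Walk.concat_cons]
  have hconst : ∀ {x y} (q : G.Walk x y), u ∉ q.support →
      ∀ z ∈ q.support, (p z).snd = (p x).snd := by
    intro x y q
    induction q with
    | nil => intro _ z hz; simp at hz; rw [hz]
    | cons h q ih =>
      intro hu z hz
      simp only [SimpleGraph.Walk.support_cons, List.mem_cons, not_or] at hu hz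
      rcases hz with rfl | hz
      · rfl
      · rw [ih hu.2 z hz]
        exact hstep h.symm (fun e => hu.2 (e ▸ q.start_mem_support)) (Ne.symm hu.1)
  have hwalk : ∀ x, x ≠ u → G.Adj u (p x).snd ∧
      ∃ q : G.Walk (p x).snd x, ∀ z ∈ q.support, (p z).snd = (p x).snd := by
    intro x hx
    have hpx := hp x
    generalize p x = q at hpx ⊢
    cases q with
    | nil => exact absurd rfl hx
    | cons h q =>
      rw [SimpleGraph.Walk.cons_isPath_iff] at hpx
      rw [SimpleGraph.Walk.snd_cons]
      exact ⟨h, q, fun z hz => by rw [hconst q hpx.2 z hz, hadjroot h]⟩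
  refine ⟨fun x => (p x).snd, hroot, fun hx => (hwalk _ hx).1, hadjroot, hstep, fun x => ?_⟩
  by_cases hx : x = u
  · subst hx
    refine ⟨SimpleGraph.Walk.nil.copy hroot.symm rfl, fun z hz => ?_⟩
    simp at hz
    rw [hz]
  · exact (hwalk x hx).2

namespace IsBranchMap

variable {G : SimpleGraph V} {u : V} {b : V → V}

theorem apply_ne_root (hb : IsBranchMap G u b) {x : V} (hx : x ≠ u) : b x ≠ u := (hb.adj hx).ne'

theorem eq_root_iff (hb : IsBranchMap G u b) {x : V} : b x = u ↔ x = u :=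
  ⟨fun h => by_contra fun hx => hb.apply_ne_root hx h, fun h => h ▸ hb.root⟩

theorem idem (hb : IsBranchMap G u b) (x : V) : b (b x) = b x := by
  by_cases hx : x = u
  · rw [hx, hb.root, hb.root]
  · exact hb.of_adj_root (hb.adj hx)

/-- Branches are connected: walk inside the branch between its representative and whichever of `x`,
`y` disagrees with it about `P`. -/
theorem exists_boundary_in_branch (hb : IsBranchMap G u b) {P : V → Prop} {x y : V}
    (hxy : b x = b y) (hx : P x) (hy : ¬ P y) :
    ∃ s t, G.Adj s t ∧ b s = b x ∧ b t = b x ∧ P s ∧ ¬ P t := by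
  obtain ⟨p, hp⟩ := hb.walk x
  obtain ⟨q, hq⟩ := hb.walk y
  by_cases h : P (b x)
  · obtain ⟨d, hd, h1, h2⟩ := (q.copy hxy.symm rfl).exists_boundary_dart {z | P z} h hy
    rw [SimpleGraph.Walk.darts_copy] at hd
    exact ⟨d.fst, d.snd, d.adj, (hq _ (q.dart_fst_mem_support_of_mem_darts hd)).trans hxy.symm,
      (hq _ (q.dart_snd_mem_support_of_mem_darts hd)).trans hxy.symm, h1, h2⟩
  · obtain ⟨d, hd, h1, h2⟩ := p.reverse.exists_boundary_dart {z | P z} hx h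
    have hs := p.reverse.dart_fst_mem_support_of_mem_darts hd
    have ht := p.reverse.dart_snd_mem_support_of_mem_darts hd
    rw [SimpleGraph.Walk.support_reverse, List.mem_reverse] at hs ht
    exact ⟨d.fst, d.snd, d.adj, hp _ hs, hp _ ht, h1, h2⟩

theorem exists_boundary_to_root (hb : IsBranchMap G u b) {P : V → Prop} {x : V}
    (hx : P x) (hu : ¬ P u) :
    ∃ s t, G.Adj s t ∧ b s = b x ∧ (b t = b x ∨ t = u) ∧ P s ∧ ¬ P t := by
  by_cases h : P (b x)
  · exact ⟨b x, u, (hb.adj fun e => hu (e ▸ hx)).symm, hb.idem x, .inr rfl, h, hu⟩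
  · obtain ⟨s, t, hst, h1, h2, h3⟩ := hb.exists_boundary_in_branch (hb.idem x).symm hx h
    exact ⟨s, t, hst, h1, .inl h2, h3⟩

theorem swap_apply (hb : IsBranchMap G u b) [DecidableEq V] {w : V} (hw : G.Adj u w) {x : V}
    (hx : b x = x) : b (Equiv.swap u w x) = Equiv.swap u w x := by
  rw [Equiv.swap_apply_def]
  split_ifs
  · exact hb.of_adj_root hw
  · exact hb.root
  · exact hx

end IsBranchMap

end BranchMap

/-! ### Projectivity and contiguity of branches. -/

section Contiguous

variable {V : Type*} [Fintype V]

/-- Every fibre of `b` occupies an interval of positions. -/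
def BranchesContiguous (b : V → V) (π : Arrangement V) : Prop :=
  ∀ x y z, b x = b y → b z ≠ b x → π x < π z → π z < π y → False

theorem BranchesContiguous.lt_iff {b : V → V} {π : Arrangement V} (h : BranchesContiguous b π)
    {x y z : V} (hxy : b x = b y) (hz : b z ≠ b x) : π x < π z ↔ π y < π z := by
  have h1 := h x y z hxy hz
  have h2 := h y x z hxy.symm (hxy ▸ hz)
  have hx : π x ≠ π z := fun e => hz (congrArg b (π.injective e)).symm
  have hy : π y ≠ π z := fun e => hz ((congrArg b (π.injective e)).symm.trans hxy.symm)
  constructor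
  · exact fun hlt => lt_of_le_of_ne (not_lt.1 fun hgt => h1 hlt hgt) hy
  · exact fun hlt => lt_of_le_of_ne (not_lt.1 fun hgt => h2 hlt hgt) hx

theorem BranchesContiguous.lt_iff_lt {b : V → V} {π : Arrangement V} (h : BranchesContiguous b π)
    {x x' y y' : V} (hx : b x = b x') (hy : b y = b y') (hxy : b x ≠ b y) :
    π x < π y ↔ π x' < π y' := by
  rw [h.lt_iff hx (Ne.symm hxy)]
  have hne : ∀ {a c : V}, b a ≠ b c → π a ≠ π c := fun hac e => hac (congrArg b (π.injective e))
  have h1 : π x' < π y ↔ ¬ π y < π x' := by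
    rw [not_lt, (hne (hx ▸ hxy)).le_iff_lt]
  have h2 : π x' < π y' ↔ ¬ π y' < π x' := by
    rw [not_lt, (hne (hx ▸ hy ▸ hxy)).le_iff_lt]
  rw [h1, h2, h.lt_iff hy (hx ▸ hxy)]

variable {G : SimpleGraph V} {u : V} {b : V → V}

/-- If a foreign `z` splits a branch, some edge `st` of that branch spans `z`. It cannot cover the
root, so `z ≠ u` and the root is not strictly between `s` and `t`. Going from `z` to the root, some
edge leaves this interval at a vertex outside the branch, hence distinct from `s` and `t`, and
crosses `st`. -/
theorem IsProjective.branchesContiguous (hb : IsBranchMap G u b) {π : Arrangement V}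
    (hπ : IsProjective G u π) : BranchesContiguous b π := by
  intro x y z hxy hz hxz hzy
  have hpl := isPlanar_iff.1 hπ.1
  have hcov := not_isCovered_iff.1 hπ.2
  obtain ⟨s, t, hst, hs, ht, hsz, hzt⟩ := hb.exists_boundary_in_branch
    (P := fun v => π v < π z) hxy hxz (not_lt.2 hzy.le)
  have hne : ∀ {v w : V}, b v = b x → b w ≠ b x → π w ≠ π v :=
    fun hv hw e => hw ((congrArg b (π.injective e)).trans hv)
  have hzt : π z < π t := lt_of_le_of_ne (not_lt.1 hzt) (hne ht hz)
  by_cases hzu : z = u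
  · exact hcov s t hst (hzu ▸ hsz) (hzu ▸ hzt)
  have hxu : b u ≠ b x := by
    intro e
    rw [hb.root, eq_comm, hb.eq_root_iff] at e
    rw [e, hb.root] at hxy
    rw [e] at hxz
    rw [hb.eq_root_iff.1 hxy.symm] at hzy
    exact lt_asymm hxz hzy
  obtain ⟨p, q, hpq, hp, hq, ⟨hp1, hp2⟩, hq'⟩ := hb.exists_boundary_to_root
    (P := fun v => π s < π v ∧ π v < π t) ⟨hsz, hzt⟩ (fun h => hcov s t hst h.1 h.2)
  have hqx : b q ≠ b x := by
    rcases hq with hq | rfl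
    · rwa [hq]
    · exact hxu
  rcases lt_or_gt_of_ne (hne hs hqx) with hlt | hgt
  · exact hpl q p s t hpq.symm hst hlt hp1 hp2
  · have : π t < π q := lt_of_le_of_ne (not_lt.1 fun h => hq' ⟨hgt, h⟩) (hne ht hqx).symm
    exact hpl s t p q hst hpq hp1 hp2 this

/-- An arrangement in which the branches at the root are contiguous and internally ordered as in
a projective arrangement is projective. -/
theorem IsProjective.of_branches (hb : IsBranchMap G u b) {π ρ : Arrangement V}
    (hπ : IsProjective G u π) (hρ : BranchesContiguous b ρ)
    (hord : ∀ x y, b x = b y → (ρ x < ρ y ↔ π x < π y)) : IsProjective G u ρ := by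
  have hpl := isPlanar_iff.1 hπ.1
  have hcov := not_isCovered_iff.1 hπ.2
  have hc := hπ.branchesContiguous hb
  have hroot : ∀ {v}, v ≠ u → b u ≠ b v := fun hv => by
    rw [hb.root]; exact (hb.apply_ne_root hv).symm
  -- An edge avoiding the root spans only vertices of its own branch, where `ρ` and `π` agree.
  have hinner : ∀ s t, G.Adj s t → s ≠ u → t ≠ u → ∀ z, ρ s < ρ z → ρ z < ρ t →
      b z = b s ∧ π s < π z ∧ π z < π t := by
    intro s t hst hs ht z h1 h2
    have hbst := hb.of_adj hst hs ht
    have hz : b z = b s := by_contra fun hz => hρ s t z hbst hz h1 h2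
    exact ⟨hz, (hord _ _ hz.symm).1 h1, (hord _ _ (hz.trans hbst)).1 h2⟩
  have hnocov : ∀ s t, G.Adj s t → ρ s < ρ u → ρ u < ρ t → False := by
    intro s t hst h1 h2
    have hs : s ≠ u := by rintro rfl; exact lt_irrefl _ h1
    have ht : t ≠ u := by rintro rfl; exact lt_irrefl _ h2
    exact hroot hs (hinner s t hst hs ht u h1 h2).1
  -- If `st` spanned a root neighbour `v`, then in `π` the root would be covered by `st` or the edge
  -- `uv` would cross it.
  have hedge : ∀ s t, G.Adj s t → s ≠ u → t ≠ u → ∀ v, G.Adj u v →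
      ρ s < ρ v → ρ v < ρ t → False := by
    intro s t hst hs ht v huv h1 h2
    obtain ⟨-, h3, h4⟩ := hinner s t hst hs ht v h1 h2
    rcases lt_trichotomy (π u) (π s) with h | h | h
    · exact hpl u v s t huv hst h h3 h4
    · exact hs (π.injective h).symm
    · rcases lt_trichotomy (π u) (π t) with h' | h' | h'
      · exact hcov s t hst h h'
      · exact ht (π.injective h').symm
      · exact hpl s t v u hst huv.symm h3 h4 h'
  refine ⟨isPlanar_iff.2 fun s t p q hst hpq h1 h2 h3 => ?_, not_isCovered_iff.2 hnocov⟩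
  have hpu : p ≠ u := by rintro rfl; exact hnocov s t hst h1 h2
  have htu : t ≠ u := by rintro rfl; exact hnocov p q hpq h2 h3
  by_cases hsu : s = u
  · subst hsu
    have hqs : q ≠ s := by rintro rfl; exact absurd (h1.trans (h2.trans h3)) (lt_irrefl _)
    exact hedge p q hpq hpu hqs t hst h2 h3
  by_cases hqu : q = u
  · subst hqu
    exact hedge s t hst hsu htu p hpq.symm h1 h2
  obtain ⟨h4, h5, h6⟩ := hinner s t hst hsu htu p h1 h2
  obtain ⟨-, -, h7⟩ := hinner p q hpq hpu hqu t h2 h3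
  exact hpl s t p q hst hpq h5 h6 h7

end Contiguous

/-! ### Permuting blocks. -/

section Permute

variable {V : Type*} [Fintype V]

theorem branchKey_injective (b : V → V) (σ : Equiv.Perm V) (π : Arrangement V) :
    Function.Injective fun x => toLex (π (σ (b x)), π x) := fun x y h => by
  simpa using congrArg (fun k => (ofLex k).2) h

/-- Rearrange the fibres of `b` according to the permutation `σ` of their representatives, keeping
the order within every fibre. -/
noncomputable def permuteBranches (b : V → V) (σ : Equiv.Perm V) (π : Arrangement V) :
    Arrangement V :=
  ofKey (fun x => toLex (π (σ (b x)), π x)) (branchKey_injective b σ π)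

variable {b : V → V} {σ : Equiv.Perm V}

theorem permuteBranches_lt_of_eq {π : Arrangement V} {x y : V} (h : b x = b y) :
    permuteBranches b σ π x < permuteBranches b σ π y ↔ π x < π y := by
  rw [permuteBranches, ofKey_lt_ofKey_iff, Prod.Lex.toLex_lt_toLex]
  simp [h]

theorem permuteBranches_lt_of_ne {π : Arrangement V} {x y : V} (h : b x ≠ b y) :
    permuteBranches b σ π x < permuteBranches b σ π y ↔ π (σ (b x)) < π (σ (b y)) := by
  rw [permuteBranches, ofKey_lt_ofKey_iff, Prod.Lex.toLex_lt_toLex]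
  simp [h]

theorem branchesContiguous_permuteBranches (b : V → V) (σ : Equiv.Perm V) (π : Arrangement V) :
    BranchesContiguous b (permuteBranches b σ π) := by
  intro x y z hxy hz h1 h2
  rw [permuteBranches_lt_of_ne (Ne.symm hz)] at h1
  rw [permuteBranches_lt_of_ne (hxy ▸ hz), ← hxy] at h2
  exact lt_asymm h1 h2

/-- Only the order of the blocks changes, and it is read off at representatives. So `σ.symm` must
map representatives to representatives, and contiguity of `π` lets the order of two blocks be read
there. -/
theorem permuteBranches_symm_permuteBranches {π : Arrangement V} (hπ : BranchesContiguous b π)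
    (hb : ∀ x, b (b x) = b x) (hσ : ∀ x, b (σ.symm (b x)) = σ.symm (b x)) :
    permuteBranches b σ.symm (permuteBranches b σ π) = π := by
  refine arrangement_ext fun x y => ?_
  by_cases h : b x = b y
  · rw [permuteBranches_lt_of_eq h, permuteBranches_lt_of_eq h]
  · rw [permuteBranches_lt_of_ne h, permuteBranches_lt_of_ne (by simpa [hσ] using h)]
    simp only [hσ, Equiv.apply_symm_apply]
    exact hπ.lt_iff_lt (hb x) (hb y) (by simpa [hb] using h)

end Permute

/-! ### The root–branch exchange as an involution on projective arrangements. -/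

section Swap

open scoped Classical in
/-- Exchange the root `u` with the branch of `w`. -/
noncomputable def swapBranch {V : Type*} [Fintype V] (b : V → V) (u w : V) (π : Arrangement V) :
    Arrangement V :=
  permuteBranches b (Equiv.swap u w) π

variable {V : Type*} [Fintype V] {G : SimpleGraph V} {u w : V} {b : V → V} {π : Arrangement V}

theorem swapBranch_swapBranch (hb : IsBranchMap G u b) (hw : G.Adj u w)
    (hπ : IsProjective G u π) : swapBranch b u w (swapBranch b u w π) = π := by
  unfold swapBranch
  classical
  have := permuteBranches_symm_permuteBranches (σ := Equiv.swap u w)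
    (hπ.branchesContiguous hb) hb.idem fun x => by
      rw [Equiv.symm_swap]; exact hb.swap_apply hw (hb.idem x)
  rw [Equiv.symm_swap] at this
  convert this

theorem isProjective_swapBranch (hb : IsBranchMap G u b) (w : V)
    (hπ : IsProjective G u π) : IsProjective G u (swapBranch b u w π) :=
  hπ.of_branches hb (branchesContiguous_permuteBranches _ _ _)
    fun _ _ h => permuteBranches_lt_of_eq h

theorem sum_swapBranch (hb : IsBranchMap G u b) (hw : G.Adj u w) (F : Arrangement V → ℝ) :
    ∑ π ∈ projectiveArrangements G u, F (swapBranch b u w π) =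
      ∑ π ∈ projectiveArrangements G u, F π := by
  have hmem : ∀ π ∈ projectiveArrangements G u,
      swapBranch b u w π ∈ projectiveArrangements G u := fun π hπ =>
    mem_projectiveArrangements.2 (isProjective_swapBranch hb w (mem_projectiveArrangements.1 hπ))
  have hinv : ∀ π ∈ projectiveArrangements G u, swapBranch b u w (swapBranch b u w π) = π :=
    fun π hπ => swapBranch_swapBranch hb hw (mem_projectiveArrangements.1 hπ)
  exact Finset.sum_nbij' (swapBranch b u w) (swapBranch b u w) hmem hmem hinv hinv
    fun _ _ => rfl

end Swap

open scoped Classical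

/-! ### Edge length as a count of vertices in between. -/

section Between

variable {V : Type*} [Fintype V]

/-- The vertex `z` lies strictly between `x` and `y` in `π`. -/
def IsBetween (π : Arrangement V) (x z y : V) : Prop :=
  π x < π z ∧ π z < π y ∨ π y < π z ∧ π z < π x

theorem isBetween_comm {π : Arrangement V} {x y z : V} :
    IsBetween π x z y ↔ IsBetween π y z x := or_comm

theorem abs_pos_sub_pos (π : Arrangement V) {x y : V} (hxy : x ≠ y) :
    |(pos π x : ℝ) - pos π y| = 1 + ∑ z, if IsBetween π x z y then 1 else 0 := by
  wlog h : π x < π y generalizing x y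
  · rw [abs_sub_comm, this hxy.symm
      (lt_of_le_of_ne (not_lt.1 h) fun e => hxy (π.injective e).symm)]
    simp only [isBetween_comm]
  have hcard : (Finset.univ.filter fun z => IsBetween π x z y).card = (π y : ℕ) - π x - 1 := by
    rw [← Fin.card_Ioo, ← Finset.card_map π.toEmbedding]
    congr 1
    ext i
    rw [Finset.mem_map_equiv, Finset.mem_filter, Finset.mem_Ioo, IsBetween]
    simp only [Finset.mem_univ, true_and, Equiv.apply_symm_apply]
    exact ⟨fun h' => h'.elim id fun h'' => absurd (h''.1.trans h''.2) (lt_asymm h), Or.inl⟩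
  rw [Finset.sum_boole, hcard]
  have h' : (π x : ℕ) + 1 ≤ π y := h
  obtain ⟨k, hk⟩ := Nat.exists_eq_add_of_le h'
  simp only [pos, hk]
  rw [show (π x : ℕ) + 1 + k - π x - 1 = k by omega]
  push_cast
  rw [abs_of_nonpos (by linarith [Nat.cast_nonneg (α := ℝ) k])]
  ring

end Between

/-! ### Mean length of the edges at the root. -/

section RootEdges

variable {V : Type*} [Fintype V] {G : SimpleGraph V} {u : V} {b : V → V} {π : Arrangement V}

theorem swapBranch_lt_of_eq {w x y : V} (h : b x = b y) :
    swapBranch b u w π x < swapBranch b u w π y ↔ π x < π y := permuteBranches_lt_of_eq h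

/-- Blocks are intervals, so `x'` and `y'` may be any vertices of the blocks whose places are taken
over. -/
theorem swapBranch_lt_iff (hb : IsBranchMap G u b) {w : V} (hw : G.Adj u w)
    (hπ : IsProjective G u π) {x y x' y' : V} (hxy : b x ≠ b y)
    (hx : b x' = Equiv.swap u w (b x)) (hy : b y' = Equiv.swap u w (b y)) :
    swapBranch b u w π x < swapBranch b u w π y ↔ π x' < π y' := by
  rw [swapBranch, permuteBranches_lt_of_ne hxy]
  have e1 := hb.swap_apply hw (hb.idem x)
  have e2 := hb.swap_apply hw (hb.idem y)
  exact (hπ.branchesContiguous hb).lt_iff_lt (e1.trans hx.symm) (e2.trans hy.symm)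
    (by rw [e1, e2]; simpa using hxy)

/-- Exchanging the root with the branch of `x` exchanges the roles of the root and `x` relative
to a vertex `v` of another branch. -/
theorem isBetween_swapBranch_of_ne (hb : IsBranchMap G u b) (hπ : IsProjective G u π) {x v : V}
    (hx : x ≠ u) (hv : v ≠ u) (hxv : b x ≠ b v) :
    IsBetween (swapBranch b u (b x) π) u x v ↔ IsBetween π x u v := by
  have hux : b u ≠ b x := by rw [hb.root]; exact (hb.apply_ne_root hx).symm
  have huv : b u ≠ b v := by rw [hb.root]; exact (hb.apply_ne_root hv).symm
  have ex : b u = Equiv.swap u (b x) (b x) := by rw [Equiv.swap_apply_right, hb.root]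
  have eu : b x = Equiv.swap u (b x) (b u) := by rw [hb.root, Equiv.swap_apply_left]
  have ev : b v = Equiv.swap u (b x) (b v) :=
    (Equiv.swap_apply_of_ne_of_ne (hb.apply_ne_root hv) hxv.symm).symm
  have hw := hb.adj hx
  simp only [IsBetween, swapBranch_lt_iff hb hw hπ hux eu ex,
    swapBranch_lt_iff hb hw hπ hux.symm ex eu, swapBranch_lt_iff hb hw hπ hxv ex ev,
    swapBranch_lt_iff hb hw hπ hxv.symm ev ex]

/-- The exchange moves the root to the other side of the branch of `v` and keeps the order of `x`
and `v`. -/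
theorem isBetween_swapBranch_of_eq (hb : IsBranchMap G u b) (hπ : IsProjective G u π) {x v : V}
    (hv : G.Adj u v) (hx : b x = v) (hxv : x ≠ v) :
    IsBetween (swapBranch b u v π) u x v ↔ ¬ IsBetween π u x v := by
  have hxu : x ≠ u := by rintro rfl; exact hv.ne (hb.root.symm.trans hx)
  have hbv : b v = v := hb.of_adj_root hv
  have hux : b u ≠ b x := by rw [hb.root]; exact (hb.apply_ne_root hxu).symm
  have ex : b u = Equiv.swap u v (b x) := by rw [hx, Equiv.swap_apply_right, hb.root]
  have eu : b x = Equiv.swap u v (b u) := by rw [hb.root, Equiv.swap_apply_left, hx]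
  have hc := hπ.branchesContiguous hb
  have h1 := hc.lt_iff_lt (x := u) (x' := u) (y := x) (y' := v) rfl (hx.trans hbv.symm) hux
  have h2 := hc.lt_iff_lt (x := x) (x' := v) (y := u) (y' := u) (hx.trans hbv.symm) rfl hux.symm
  have n1 : π x ≠ π u := fun e => hxu (π.injective e)
  have n2 : π x ≠ π v := fun e => hxv (π.injective e)
  simp only [IsBetween, swapBranch_lt_iff hb hv hπ hux eu ex,
    swapBranch_lt_iff hb hv hπ hux.symm ex eu, swapBranch_lt_of_eq (hx.trans hbv.symm),
    swapBranch_lt_of_eq (hbv.trans hx.symm)]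
  grind

theorem sum_isBetween_of_eq (hb : IsBranchMap G u b) {x v : V} (hv : G.Adj u v) (hx : b x = v)
    (hxv : x ≠ v) :
    ∑ π ∈ projectiveArrangements G u, (if IsBetween π u x v then (1 : ℝ) else 0) =
      (projectiveArrangements G u).card * (1 / 2) := by
  have h := sum_swapBranch hb hv fun π => if IsBetween π u x v then (1 : ℝ) else 0
  have h' : ∑ π ∈ projectiveArrangements G u,
      ((if IsBetween π u x v then (1 : ℝ) else 0) +
        if IsBetween (swapBranch b u v π) u x v then (1 : ℝ) else 0) =
      ∑ π ∈ projectiveArrangements G u, (1 : ℝ) := by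
    refine Finset.sum_congr rfl fun π hπ => ?_
    rw [isBetween_swapBranch_of_eq hb (mem_projectiveArrangements.1 hπ) hv hx hxv]
    by_cases hB : IsBetween π u x v <;> simp [hB]
  rw [Finset.sum_add_distrib, h] at h'
  simp only [Finset.sum_const, nsmul_eq_mul, mul_one] at h'
  linarith

/-- Exactly one of `u`, `x`, `v` is in the middle, and exchanging the root with the branch of `x` or
of `v` shows the three cases equally frequent. -/
theorem sum_isBetween_of_ne (hb : IsBranchMap G u b) {x v : V} (hx : x ≠ u) (hv : v ≠ u)
    (hxv : b x ≠ b v) :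
    ∑ π ∈ projectiveArrangements G u, (if IsBetween π u x v then (1 : ℝ) else 0) =
      (projectiveArrangements G u).card * (1 / 3) := by
  have key : ∀ {x v : V}, x ≠ u → v ≠ u → b x ≠ b v →
      ∑ π ∈ projectiveArrangements G u, (if IsBetween π u x v then (1 : ℝ) else 0) =
      ∑ π ∈ projectiveArrangements G u, (if IsBetween π x u v then (1 : ℝ) else 0) := by
    intro x v hx hv hxv
    rw [← sum_swapBranch hb (hb.adj hx)]
    refine Finset.sum_congr rfl fun π hπ => ?_
    simp only [isBetween_swapBranch_of_ne hb (mem_projectiveArrangements.1 hπ) hx hv hxv]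
  have h1 := key hx hv hxv
  have h2 := key hv hx hxv.symm
  simp only [isBetween_comm (x := v) (z := u) (y := x)] at h2
  have h' : ∑ π ∈ projectiveArrangements G u,
      ((if IsBetween π u x v then (1 : ℝ) else 0) + (if IsBetween π u v x then (1 : ℝ) else 0) +
        if IsBetween π x u v then (1 : ℝ) else 0) =
      ∑ π ∈ projectiveArrangements G u, (1 : ℝ) := by
    refine Finset.sum_congr rfl fun π _ => ?_
    have n1 : π x ≠ π u := fun e => hx (π.injective e)
    have n2 : π v ≠ π u := fun e => hv (π.injective e)
    have n3 : π x ≠ π v := fun e => hxv (congrArg b (π.injective e))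
    simp only [IsBetween]
    rcases lt_or_gt_of_ne n1 with a1 | a1 <;> rcases lt_or_gt_of_ne n2 with a2 | a2 <;>
      rcases lt_or_gt_of_ne n3 with a3 | a3 <;>
      simp [a1, a2, a3, a1.not_gt, a2.not_gt, a3.not_gt] <;>
      exact absurd (lt_trans ‹_› ‹_›) (lt_asymm ‹_›)
  simp only [Finset.sum_add_distrib, Finset.sum_const, nsmul_eq_mul, mul_one] at h'
  linarith

theorem sum_dist_root (hb : IsBranchMap G u b) {v : V} (hv : G.Adj u v) :
    ∑ π ∈ projectiveArrangements G u, |(pos π u : ℝ) - pos π v| =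
      (projectiveArrangements G u).card * (((Fintype.card V : ℝ) + 1) / 3 +
        ((∑ x, if b x = v then (1 : ℝ) else 0) - 1) / 6) := by
  simp only [abs_pos_sub_pos _ hv.ne]
  rw [Finset.sum_add_distrib, Finset.sum_comm]
  -- Base value `1/3`, raised to `1/2` in the branch of `v`; the last two terms cancel the
  -- contributions of `u` and `v`, which are never strictly between.
  have hterm : ∀ x, ∑ π ∈ projectiveArrangements G u,
      (if IsBetween π u x v then (1 : ℝ) else 0) = (projectiveArrangements G u).card *
        (1 / 3 + (if b x = v then (1 : ℝ) else 0) / 6 - (if x = u then 1 else 0) / 3 -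
          (if x = v then 1 else 0) / 2) := by
    intro x
    by_cases hxu : x = u
    · subst hxu
      simp [IsBetween, hv.ne, hb.root]
    by_cases hxv : x = v
    · subst hxv
      simp [IsBetween, hv.ne', hb.of_adj_root hv]
      right; norm_num
    by_cases hbx : b x = v
    · rw [sum_isBetween_of_eq hb hv hbx hxv]
      simp [hbx, hxu, hxv]
      left; norm_num
    · rw [sum_isBetween_of_ne hb hxu hv.ne' (by rwa [hb.of_adj_root hv])]
      simp [hbx, hxu, hxv]
  simp only [hterm]
  rw [← Finset.mul_sum, Finset.sum_sub_distrib, Finset.sum_sub_distrib, Finset.sum_add_distrib,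
    ← Finset.sum_div]
  simp only [← Finset.sum_div, Finset.sum_const, nsmul_eq_mul, Finset.sum_ite_eq', Finset.mem_univ,
    if_true, Finset.card_univ]
  ring

theorem sum_sum_dist_root (hb : IsBranchMap G u b) :
    ∑ π ∈ projectiveArrangements G u, ∑ v ∈ G.neighborFinset u, |(pos π u : ℝ) - pos π v| =
      (projectiveArrangements G u).card * ((2 * G.degree u * (Fintype.card V : ℝ) + G.degree u +
        Fintype.card V - 1) / 6) := by
  -- The branches partition the vertices other than the root.
  have hn : ∑ v ∈ G.neighborFinset u, ∑ x, (if b x = v then (1 : ℝ) else 0) =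
      Fintype.card V - 1 := by
    rw [Finset.sum_comm]
    have : ∀ x, ∑ v ∈ G.neighborFinset u, (if b x = v then (1 : ℝ) else 0) =
        1 - if x = u then 1 else 0 := by
      intro x
      rw [Finset.sum_ite_eq]
      by_cases hx : x = u
      · simp [hx, hb.root]
      · simp [hx, hb.adj hx]
    simp [this, Finset.sum_sub_distrib]
  rw [Finset.sum_comm, Finset.sum_congr rfl fun v hv =>
    sum_dist_root hb ((G.mem_neighborFinset u v).1 hv), ← Finset.mul_sum, Finset.sum_add_distrib]
  simp only [← Finset.sum_div, Finset.sum_sub_distrib, hn, Finset.sum_const, nsmul_eq_mul,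
    SimpleGraph.card_neighborFinset_eq_degree]
  ring

end RootEdges

/-! ### Edges avoiding the root, and the choice of the first block. -/

section InnerEdges

variable {V : Type*} [Fintype V] {G : SimpleGraph V} {u : V} {b : V → V} {π : Arrangement V}

/-- The sum of the lengths of the edges not incident to `u`. -/
noncomputable def innerLength (G : SimpleGraph V) (u : V) (π : Arrangement V) : ℝ :=
  ∑ e ∈ G.edgeFinset with u ∉ e, edgeLength π e

theorem sumEdgeLengths_eq (G : SimpleGraph V) (u : V) (π : Arrangement V) :
    sumEdgeLengths G π =
      ∑ v ∈ G.neighborFinset u, |(pos π u : ℝ) - pos π v| + innerLength G u π := by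
  rw [sumEdgeLengths, innerLength, ← Finset.sum_filter_add_sum_filter_not _ (fun e => u ∈ e)]
  congr 1
  have himg : G.edgeFinset.filter (fun e => u ∈ e) =
      (G.neighborFinset u).image fun v => s(u, v) := by
    ext e
    induction e with
    | h x y =>
      simp only [Finset.mem_filter, SimpleGraph.mem_edgeFinset, SimpleGraph.mem_edgeSet,
        Sym2.mem_iff, Finset.mem_image, SimpleGraph.mem_neighborFinset, Sym2.eq_iff]
      constructor
      · rintro ⟨h, rfl | rfl⟩
        · exact ⟨y, h, .inl ⟨rfl, rfl⟩⟩
        · exact ⟨x, h.symm, .inr ⟨rfl, rfl⟩⟩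
      · rintro ⟨v, h, ⟨rfl, rfl⟩ | ⟨rfl, rfl⟩⟩
        · exact ⟨h, .inl rfl⟩
        · exact ⟨h.symm, .inr rfl⟩
  rw [himg, Finset.sum_image fun v _ w _ h => Sym2.congr_right.1 h]
  rfl

/-- Everything between the ends of such an edge is in their common branch, whose internal order is
untouched. -/
theorem innerLength_swapBranch (hb : IsBranchMap G u b) (w : V) (hπ : IsProjective G u π) :
    innerLength G u (swapBranch b u w π) = innerLength G u π := by
  refine Finset.sum_congr rfl fun e he => ?_
  induction e with
  | h s t =>
    simp only [Finset.mem_filter, SimpleGraph.mem_edgeFinset, SimpleGraph.mem_edgeSet,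
      Sym2.mem_iff, not_or] at he
    obtain ⟨hst, hs, ht⟩ := he
    have hbst := hb.of_adj hst (Ne.symm hs) (Ne.symm ht)
    have hout : ∀ {ρ : Arrangement V}, BranchesContiguous b ρ → ∀ z, b z ≠ b s →
        ¬ IsBetween ρ s z t := by
      rintro ρ hρ z hz (h | h)
      · exact hρ s t z hbst hz h.1 h.2
      · exact hρ t s z hbst.symm (hbst ▸ hz) h.1 h.2
    have hbtw : ∀ z, IsBetween (swapBranch b u w π) s z t ↔ IsBetween π s z t := by
      intro z
      by_cases hz : b z = b s
      · simp only [IsBetween, swapBranch_lt_of_eq hz.symm, swapBranch_lt_of_eq hz,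
          swapBranch_lt_of_eq (hz.trans hbst), swapBranch_lt_of_eq (hz.trans hbst).symm]
      · exact iff_of_false (hout (branchesContiguous_permuteBranches _ _ _) z hz)
          (hout (hπ.branchesContiguous hb) z hz)
    change |(_ : ℝ) - _| = |(_ : ℝ) - _|
    simp only [abs_pos_sub_pos _ hst.ne, hbtw]

/-- The branch represented by `k` comes first in `π`. -/
def IsFirstBranch (b : V → V) (k : V) (π : Arrangement V) : Prop :=
  ∀ z, b z ≠ k → π k < π z

theorem isFirstBranch_iff (hb : IsBranchMap G u b) (hπ : IsProjective G u π) {k x : V}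
    (hk : b k = k) (hx : (π x : ℕ) = 0) : IsFirstBranch b k π ↔ b x = k := by
  constructor
  · intro h
    by_contra hne
    have := h x hne
    simp [Fin.lt_def, hx] at this
  · intro h z hz
    refine ((hπ.branchesContiguous hb).lt_iff (x := x) (h.trans hk.symm) (h ▸ hz)).1 ?_
    refine lt_of_le_of_ne (by simp [Fin.le_def, hx]) fun e => hz ?_
    rw [← π.injective e, h]

theorem isFirstBranch_swapBranch (hb : IsBranchMap G u b) {w : V} (hw : G.Adj u w)
    (hπ : IsProjective G u π) {k : V} (hk : b k = k) (h : IsFirstBranch b k π) :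
    IsFirstBranch b (Equiv.swap u w k) (swapBranch b u w π) := by
  intro z hz
  have e1 := hb.swap_apply hw hk
  rw [swapBranch_lt_iff hb hw hπ (x' := k) (y' := Equiv.swap u w (b z)) (by rwa [e1, ne_comm])
    (by rw [e1, Equiv.swap_apply_self, hk]) (hb.swap_apply hw (hb.idem z))]
  refine h _ ?_
  rw [hb.swap_apply hw (hb.idem z)]
  intro e
  rw [← e, Equiv.swap_apply_self] at hz
  exact hz rfl

/-- A swap-invariant function has `degree u + 1` times the sum over all projective arrangements
that it has over those starting with the root. -/
theorem sum_projective_of_invariant (hb : IsBranchMap G u b) (F : Arrangement V → ℝ)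
    (hF : ∀ w π, G.Adj u w → IsProjective G u π → F (swapBranch b u w π) = F π) :
    ∑ π ∈ projectiveArrangements G u, F π =
      (G.degree u + 1) * ∑ π ∈ projectiveArrangementsFixed G u, F π := by
  have : NeZero (Fintype.card V) := ⟨(Fintype.card_pos_iff.2 ⟨u⟩).ne'⟩
  have hx : ∀ π : Arrangement V, (π (π.symm 0) : ℕ) = 0 := fun π => by simp
  have hmaps : ∀ π ∈ projectiveArrangements G u,
      b (π.symm 0) ∈ insert u (G.neighborFinset u) := by
    intro π _
    by_cases h : π.symm 0 = u
    · rw [h, hb.root]; exact Finset.mem_insert_self _ _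
    · exact Finset.mem_insert_of_mem ((G.mem_neighborFinset _ _).2 (hb.adj h))
  have hfix : (projectiveArrangements G u).filter (fun π => b (π.symm 0) = u) =
      projectiveArrangementsFixed G u := by
    ext π
    rw [Finset.mem_filter, mem_projectiveArrangements, mem_projectiveArrangementsFixed,
      hb.eq_root_iff, Equiv.symm_apply_eq, Fin.ext_iff, Fin.val_zero, eq_comm (a := 0)]
    exact ⟨fun h => ⟨h.1.1, h.2⟩, fun h => ⟨⟨h.1, not_isCovered_of_first h.2⟩, h.2⟩⟩
  -- The exchange matches arrangements whose first block is the branch of `w` with those whose first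
  -- block is the root, so all `degree u + 1` classes have equal sums.
  have hstep : ∀ w, G.Adj u w →
      ∑ π ∈ projectiveArrangements G u with b (π.symm 0) = w, F π =
      ∑ π ∈ projectiveArrangements G u with b (π.symm 0) = u, F π := by
    intro w hw
    have hmem : ∀ {k l}, b k = k → Equiv.swap u w k = l →
        ∀ π ∈ (projectiveArrangements G u).filter (fun π => b (π.symm 0) = k),
        swapBranch b u w π ∈ (projectiveArrangements G u).filter (fun π => b (π.symm 0) = l) := by
      intro k l hk hkl π hπ
      rw [Finset.mem_filter, mem_projectiveArrangements] at hπ ⊢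
      have hπ' := isProjective_swapBranch hb w hπ.1
      have hl : b l = l := hkl ▸ hb.swap_apply hw hk
      refine ⟨hπ', (isFirstBranch_iff hb hπ' hl (hx _)).1 ?_⟩
      exact hkl ▸ isFirstBranch_swapBranch hb hw hπ.1 hk
        ((isFirstBranch_iff hb hπ.1 hk (hx _)).2 hπ.2)
    have hproj : ∀ {k}, ∀ π ∈ (projectiveArrangements G u).filter (fun π => b (π.symm 0) = k),
        IsProjective G u π := fun π hπ => mem_projectiveArrangements.1 (Finset.mem_filter.1 hπ).1
    exact Finset.sum_nbij' (swapBranch b u w) (swapBranch b u w)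
      (hmem (hb.of_adj_root hw) (Equiv.swap_apply_right _ _))
      (hmem hb.root (Equiv.swap_apply_left _ _))
      (fun π hπ => swapBranch_swapBranch hb hw (hproj π hπ))
      (fun π hπ => swapBranch_swapBranch hb hw (hproj π hπ))
      (fun π hπ => (hF w π hw (hproj π hπ)).symm)
  rw [← Finset.sum_fiberwise_of_maps_to hmaps, Finset.sum_insert (by simp),
    Finset.sum_congr rfl fun w hw => hstep w ((G.mem_neighborFinset _ _).1 hw), hfix]
  simp only [Finset.sum_const, nsmul_eq_mul, SimpleGraph.card_neighborFinset_eq_degree]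
  ring

end InnerEdges

/-! ### Comparison of the expectations. -/

section Expectation

variable {V : Type*} [Fintype V] {G : SimpleGraph V}

theorem projectiveArrangementsFixed_nonempty (hG : G.IsTree) (u : V) :
    (projectiveArrangementsFixed G u).Nonempty := by
  obtain ⟨π, hπ⟩ := planarArrangements_nonempty hG
  exact ⟨_, rotateTo_mem_projectiveArrangementsFixed (mem_planarArrangements.1 hπ) u⟩

theorem projectiveArrangements_nonempty (hG : G.IsTree) (u : V) :
    (projectiveArrangements G u).Nonempty :=
  (projectiveArrangementsFixed_nonempty hG u).mono (Finset.filter_subset _ _)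

/-- Inner edges contribute equally to both sides; the correction is `dn/2 - (2dn + d + n - 1)/6`,
with `d` the degree of `u`. -/
theorem expProjectiveFixed_eq (hG : G.IsTree) (u : V) :
    expProjectiveFixed G u = expProjective G u +
      ((G.degree u : ℝ) - 1) * ((Fintype.card V : ℝ) - 1) / 6 := by
  obtain ⟨b, hb⟩ := exists_isBranchMap hG u
  have hM : ((projectiveArrangementsFixed G u).card : ℝ) ≠ 0 :=
    Nat.cast_ne_zero.2 (projectiveArrangementsFixed_nonempty hG u).card_pos.ne'
  have hcard : ((projectiveArrangements G u).card : ℝ) =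
      (G.degree u + 1) * (projectiveArrangementsFixed G u).card := by
    simpa using sum_projective_of_invariant hb (fun _ => 1) fun _ _ _ _ => rfl
  have hinner := sum_projective_of_invariant hb (innerLength G u)
    fun w π _ hπ => innerLength_swapBranch hb w hπ
  have hfixed : ∑ π ∈ projectiveArrangementsFixed G u,
      ∑ v ∈ G.neighborFinset u, |(pos π u : ℝ) - pos π v| =
      G.degree u * ((projectiveArrangementsFixed G u).card * ((Fintype.card V : ℝ) / 2)) := by
    rw [Finset.sum_comm, Finset.sum_congr rfl fun v hv =>
      sum_fixed_dist G ((G.mem_neighborFinset u v).1 hv).ne]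
    simp
  have hd : (G.degree u + 1 : ℝ) ≠ 0 := by positivity
  rw [expProjectiveFixed, expProjective, Finset.expect_eq_sum_div_card,
    Finset.expect_eq_sum_div_card]
  simp only [sumEdgeLengths_eq G u, Finset.sum_add_distrib]
  rw [hfixed, sum_sum_dist_root hb, hinner, hcard]
  field_simp
  ring

theorem sum_expProjectiveFixed (hG : G.IsTree) :
    ∑ u, expProjectiveFixed G u = ∑ u, expProjective G u +
      ((Fintype.card V : ℝ) - 1) * ((Fintype.card V : ℝ) - 2) / 6 := by
  -- Handshake lemma with `n - 1` edges.
  have hdeg : ∑ u, (G.degree u : ℝ) = 2 * ((Fintype.card V : ℝ) - 1) := by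
    have h1 : ((∑ u, G.degree u : ℕ) : ℝ) = ((2 * G.edgeFinset.card : ℕ) : ℝ) :=
      congrArg _ G.sum_degrees_eq_twice_card_edges
    have h2 : ((G.edgeFinset.card + 1 : ℕ) : ℝ) = (Fintype.card V : ℝ) :=
      congrArg _ hG.card_edgeFinset
    push_cast at h1 h2
    rw [h1, ← h2]
    ring
  simp only [expProjectiveFixed_eq hG, Finset.sum_add_distrib]
  rw [← Finset.sum_div, ← Finset.sum_mul, Finset.sum_sub_distrib, hdeg]
  simp only [Finset.sum_const, nsmul_eq_mul, Finset.card_univ]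
  ring

end Expectation

end LinArr

theorem theorem1 {V : Type*} [Fintype V] (G : SimpleGraph V) (hG : G.IsTree) :
    (LinArr.planarArrangements G).Nonempty ∧
    (∀ u : V, (LinArr.projectiveArrangementsFixed G u).Nonempty) ∧
    (∀ u : V, (LinArr.projectiveArrangements G u).Nonempty) ∧
    LinArr.expPlanar G
      = 1 / (Fintype.card V : ℝ) * ∑ u : V, LinArr.expProjectiveFixed G u ∧
    LinArr.expPlanar G
      = ((Fintype.card V : ℝ) - 1) * ((Fintype.card V : ℝ) - 2) / (6 * (Fintype.card V : ℝ))
        + 1 / (Fintype.card V : ℝ) * ∑ u : V, LinArr.expProjective G u := by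
  refine ⟨LinArr.planarArrangements_nonempty hG, LinArr.projectiveArrangementsFixed_nonempty hG,
    LinArr.projectiveArrangements_nonempty hG, LinArr.expPlanar_eq_average hG, ?_⟩
  rw [LinArr.expPlanar_eq_average hG, LinArr.sum_expProjectiveFixed hG]
  have := hG.connected.nonempty
  have hn : (Fintype.card V : ℝ) ≠ 0 := Nat.cast_ne_zero.2 Fintype.card_ne_zero
  field_simp
  ring
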